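/- Let $d\ge 1$, $\gamma>0$, and let $\mathbb Q$ be an even Borel probability measure on the unit sphere $\mathbb S^{d-1}\subset\mathbb R^d$ that is not concentrated on a great subsphere, i.e. $\mathbb Q(\{u:\langle u,v\rangle=0\})\ne 1$ for every $v\in\mathbb S^{d-1}$. For $u\in\mathbb S^{d-1}$ and $s\in\mathbb R$ let $H_{u,s}=\{y\in\mathbb R^d:\langle y,u\rangle=s\}$, and equip the space $\mathbb H^{d-1}$ of all hyperplanes of $\mathbb R^d$ with the $\sigma$-field generated by the sets $[K]=\{H:H\cap K\neq\emptyset\}$, $K\subset\mathbb R^d$ compact. Let $\eta$ be a Poisson hyperplane process with intensity measure $$\lambda=\gamma\int_{\mathbb S^{d-1}}\int_{\mathbb R}\mathbf 1\{H_{u,s}\in\cdot\}\,ds\,\mathbb Q(du),$$ that is, a random set of hyperplanes such that $\eta\cap[K]$ is always finite for compact $K$, such that $|\eta\cap A|$ is a Poisson random variable with parameter $\lambda(A)\in[0,\infty]$ for every measurable $A\subset\mathbb H^{d-1}$ (equal to $\infty$ almost surely if $\lambda(A)=\infty$), and such that $|\eta\cap A_1|,\dots,|\eta\cap A_n|$ are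 independent for pairwise disjoint measurable $A_1,\dots,A_n$. Let $\Phi$ be the set of all points $x\in\mathbb R^d$ with $\{x\}=H_1\cap\dots\cap H_d$ for some $H_1,\dots,H_d\in\eta$. Say that $n\ge d$ points of $\mathbb R^d$ are in general hyperplane position if any $d$ of them are affinely independent and all these choices of $d$ points span the same hyperplane. Then almost surely the following is true: for any distinct points $x_1,\dots,x_{2d-1}\in\Phi$ in general hyperplane position, the affine span of $\{x_1,\dots,x_{2d-1}\}$ is a hyperplane belonging to $\eta$. -/

import Mathlib

open MeasureTheory ProbabilityTheory
open scoped ENNReal NNReal RealInnerProductSpace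

noncomputable section

namespace PoissonHyperplane

/-- Euclidean space `ℝᵈ`. -/
abbrev E (d : ℕ) : Type := EuclideanSpace ℝ (Fin d)

/-- The unit sphere of `ℝᵈ`, with its Borel sigma-field. -/
abbrev UnitSphere (d : ℕ) : Type := Metric.sphere (0 : E d) 1

/-- The affine subspace `H_{u,s} = {y : ⟪y, u⟫ = s}`. -/
def levelSubspace {d : ℕ} (u : UnitSphere d) (s : ℝ) : AffineSubspace ℝ (E d) where
  carrier := {y | ⟪y, (u : E d)⟫ = s}
  smul_vsub_vadd_mem' := by
    intro c p₁ p₂ p₃ h₁ h₂ h₃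
    simp only [Set.mem_ofPred_eq] at h₁ h₂ h₃ ⊢
    simp [inner_add_left, inner_sub_left, inner_smul_left, h₁, h₂, h₃]

/-- The hyperplanes of `ℝᵈ`: the affine subspaces `H_{u,s}`, with `u` a unit vector and
`s` real. -/
@[ext]
structure Hyperplane (d : ℕ) where
  /-- the underlying affine subspace -/
  toAffineSubspace : AffineSubspace ℝ (E d)
  exists_eq : ∃ (u : UnitSphere d) (s : ℝ), toAffineSubspace = levelSubspace u s

namespace Hyperplane

/-- The set of points of a hyperplane. -/
def points {d : ℕ} (H : Hyperplane d) : Set (E d) := (H.toAffineSubspace : Set (E d))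

/-- The hyperplane `H_{u,s} = {y : ⟪y, u⟫ = s}`. -/
def ofNormal {d : ℕ} (u : UnitSphere d) (s : ℝ) : Hyperplane d :=
  ⟨levelSubspace u s, u, s, rfl⟩

theorem mem_points_ofNormal {d : ℕ} (u : UnitSphere d) (s : ℝ) (y : E d) :
    y ∈ (ofNormal u s).points ↔ ⟪y, (u : E d)⟫ = s := Iff.rfl

end Hyperplane

/-- The set `[K]` of all hyperplanes that meet `K`. -/
def hitting {d : ℕ} (K : Set (E d)) : Set (Hyperplane d) := {H | (H.points ∩ K).Nonempty}

/-- The sigma-field on the space of hyperplanes generated by the sets `[K]`, `K` compact. -/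
instance instMeasurableSpaceHyperplane (d : ℕ) : MeasurableSpace (Hyperplane d) :=
  MeasurableSpace.generateFrom {A | ∃ K : Set (E d), IsCompact K ∧ A = hitting K}

/-- The map `(u, s) ↦ H_{u,s}` is measurable, so that its image measures are meaningful. -/
theorem measurable_ofNormal (d : ℕ) :
    Measurable (fun p : UnitSphere d × ℝ => Hyperplane.ofNormal p.1 p.2) := by
  refine measurable_generateFrom ?_
  rintro _ ⟨K, hK, rfl⟩
  have : CompactSpace K := isCompact_iff_compactSpace.mp hK
  have hC : IsClosed {q : (UnitSphere d × ℝ) × K | ⟪(q.2 : E d), (q.1.1 : E d)⟫ = q.1.2} :=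
    isClosed_eq (by fun_prop) (by fun_prop)
  have h := isClosedMap_fst_of_compactSpace _ hC
  convert h.measurableSet using 1
  ext p
  simp only [hitting, Set.mem_preimage, Set.mem_ofPred_eq, Set.mem_image]
  constructor
  · rintro ⟨y, hy, hyK⟩
    exact ⟨(p, ⟨y, hyK⟩), hy, rfl⟩
  · rintro ⟨⟨p', y⟩, hy, rfl⟩
    exact ⟨y, hy, y.2⟩

/-- The measure `γ ∫ ∫ 1{H_{u,s} ∈ ·} ds Q(du)` on the space of hyperplanes. -/
def intensityMeasure {d : ℕ} (γ : ℝ) (Q : Measure (UnitSphere d)) : Measure (Hyperplane d) :=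
  ENNReal.ofReal γ •
    (Q.prod (volume : Measure ℝ)).map (fun p => Hyperplane.ofNormal p.1 p.2)

/-- The Poisson distribution on `ℕ ∪ {∞}` with parameter `r ∈ [0, ∞]`; for `r = ∞` it is the
point mass at `∞`. -/
def poissonLaw (r : ℝ≥0∞) : Measure ℕ∞ :=
  open Classical in
  if r = ⊤ then Measure.dirac ⊤ else (poissonMeasure r.toNNReal).map (fun n : ℕ => (n : ℕ∞))

/-- `η`, a random locally finite set of hyperplanes defined on the probability space `(Ω, P)`, is
a Poisson process with intensity measure `Λ`: the number of its elements in a measurable set `A` is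
a Poisson random variable with parameter `Λ A`, and the numbers of its elements in pairwise disjoint
measurable sets are independent. -/
structure IsPoissonProcess {Ω : Type*} [MeasurableSpace Ω] {d : ℕ} (P : Measure Ω)
    (η : Ω → Set (Hyperplane d)) (Λ : Measure (Hyperplane d)) : Prop where
  locallyFinite : ∀ (ω : Ω) (K : Set (E d)), IsCompact K → (η ω ∩ hitting K).Finite
  measurable_count : ∀ A : Set (Hyperplane d), MeasurableSet A →
    Measurable (fun ω => (η ω ∩ A).encard)
  law_count : ∀ A : Set (Hyperplane d), MeasurableSet A →
    P.map (fun ω => (η ω ∩ A).encard) = poissonLaw (Λ A)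
  indep_count : ∀ (n : ℕ) (A : Fin n → Set (Hyperplane d)), (∀ i, MeasurableSet (A i)) →
    Pairwise (fun i j => Disjoint (A i) (A j)) →
    iIndepFun (fun i ω => (η ω ∩ A i).encard) P

/-- The intersection points of a set `S` of hyperplanes: all `x` with
`{x} = H₁ ∩ ⋯ ∩ H_d` for some `H₁, …, H_d ∈ S`. -/
def intersectionPoints {d : ℕ} (S : Set (Hyperplane d)) : Set (E d) :=
  {x | ∃ H : Fin d → Hyperplane d, (∀ i, H i ∈ S) ∧ ⋂ i, (H i).points = {x}}

/-- The points `x₁, …, xₙ`, `n ≥ d`, are in general hyperplane position: any `d` of them are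
affinely independent and span the same hyperplane. -/
def GeneralHyperplanePosition {d n : ℕ} (x : Fin n → E d) : Prop :=
  d ≤ n ∧ ∃ H : Hyperplane d, ∀ t : Finset (Fin n), t.card = d →
    AffineIndependent ℝ (fun i : t => x i) ∧
      affineSpan ℝ (x '' (t : Set (Fin n))) = H.toAffineSubspace

end PoissonHyperplane

end

/-! Suppose the points span a hyperplane `H` outside `η`. Fix one of them, `x o`, the intersection
of `h o 1, …, h o d` in `η`. One of the `d` edge lines through `x o`, say the one avoiding `G = h o
j`, is transversal to `H` (`exists_transversal_edge`). Since `G ≠ H`, fewer than `d` of the `2d - 1`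
points lie on `G`, so `d` of them avoid it and still span `H`. Thus `x o`, as the intersection of
that line with `H`, is determined by hyperplanes of `η` other than `G`, and yet it lies on `G`
(`exists_edgePoint_mem_points`).

Almost surely this never happens: a point that is a measurable function of finitely many hyperplanes
of `η` lies on no further one, because the hyperplanes through a fixed point have intensity zero
(`IsPoissonProcess.ae_forall_notMem_points`). This needs the intersection point as a globally
defined measurable function, which least squares solutions provide. -/

noncomputable section

namespace PoissonHyperplane

/-! ### Linear systems with at most one solution -/

/-- The least squares solution of the linear system `M a = b`. -/
def leastSquares {m n : Type*} [Fintype m] [Fintype n] [DecidableEq n]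
    (M : m → n → ℝ) (b : m → ℝ) : n → ℝ :=
  ((Matrix.of M).transpose * Matrix.of M)⁻¹.mulVec ((Matrix.of M).transpose.mulVec b)

/-- `MᵀM` has the same kernel as `M`, so it is invertible and the normal equations recover `a`. -/
theorem leastSquares_eq {m n : Type*} [Fintype m] [Fintype n] [DecidableEq n]
    {M : m → n → ℝ} {b : m → ℝ} {a : n → ℝ}
    (hM : ∀ c : n → ℝ, (∀ i, ∑ j, M i j * c j = 0) → c = 0)
    (ha : ∀ i, ∑ j, M i j * a j = b i) : leastSquares M b = a := by
  have hb : b = (Matrix.of M).mulVec a := by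
    ext i
    exact (ha i).symm
  have hinj : Function.Injective ((Matrix.of M).transpose * Matrix.of M).mulVec := by
    intro c c' h
    have h0 : ((Matrix.of M).transpose * Matrix.of M).mulVec (c - c') = 0 := by
      rw [Matrix.mulVec_sub, h, sub_self]
    rw [← Matrix.conjTranspose_eq_transpose_of_trivial,
      Matrix.conjTranspose_mul_self_mulVec_eq_zero] at h0
    exact sub_eq_zero.mp (hM _ fun i => congrFun h0 i)
  have hU := Matrix.mulVec_injective_iff_isUnit.mp hinj
  rw [leastSquares, hb, Matrix.mulVec_mulVec, Matrix.mulVec_mulVec,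
    Matrix.mul_assoc, Matrix.nonsing_inv_mul _ ((Matrix.isUnit_iff_isUnit_det _).mp hU), Matrix.one_mulVec]

/-- By Cramer's rule the entries of the inverse are adjugate entries over the determinant. With `0⁻¹
= 0` this stays measurable across singular systems. -/
theorem measurable_leastSquares {α m n : Type*} [MeasurableSpace α] [Fintype m] [Fintype n]
    [DecidableEq n] {M : α → m → n → ℝ} {b : α → m → ℝ}
    (hM : ∀ i j, Measurable fun x => M x i j) (hb : ∀ i, Measurable fun x => b x i) :
    Measurable fun x => leastSquares (M x) (b x) := by
  have hg : ∀ i j, Measurable fun x => ((Matrix.of (M x)).transpose * Matrix.of (M x)) i j := by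
    intro i j
    simp only [Matrix.mul_apply, Matrix.transpose_apply, Matrix.of_apply]
    fun_prop
  have hG : Measurable fun x i j => ((Matrix.of (M x)).transpose * Matrix.of (M x)) i j :=
    measurable_pi_lambda _ fun i => measurable_pi_lambda _ fun j => hg i j
  have hdet : Measurable fun x => ((Matrix.of (M x)).transpose * Matrix.of (M x)).det := by
    have hc : Continuous fun A : n → n → ℝ => (Matrix.of A).det :=
      Continuous.matrix_det (A := fun A : n → n → ℝ => Matrix.of A) continuous_id
    exact hc.measurable.comp hG
  have hadj : ∀ i j, Measurable fun x =>
      ((Matrix.of (M x)).transpose * Matrix.of (M x)).adjugate i j := by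
    intro i j
    have hc : Continuous fun A : n → n → ℝ => (Matrix.of A).adjugate i j :=
      (Continuous.matrix_adjugate (A := fun A : n → n → ℝ => Matrix.of A)
        continuous_id).matrix_elem i j
    exact hc.measurable.comp hG
  refine measurable_pi_lambda _ fun i => ?_
  simp only [leastSquares, Matrix.mulVec, dotProduct, Matrix.inv_def, Matrix.smul_apply,
    Ring.inverse_eq_inv', smul_eq_mul, Matrix.transpose_apply, Matrix.of_apply]
  fun_prop

/-! ### Measurable coordinates on the space of hyperplanes -/

namespace Hyperplane

variable {d : ℕ}

/-- A unit normal vector of a hyperplane. -/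
def normal (H : Hyperplane d) : E d := (H.exists_eq.choose : E d)

/-- The level of the hyperplane `H` with respect to the normal vector `H.normal`. -/
def offset (H : Hyperplane d) : ℝ := H.exists_eq.choose_spec.choose

theorem norm_normal (H : Hyperplane d) : ‖H.normal‖ = 1 :=
  mem_sphere_zero_iff_norm.mp H.exists_eq.choose.2

theorem mem_toAffineSubspace_iff (H : Hyperplane d) (y : E d) :
    y ∈ H.toAffineSubspace ↔ ⟪y, H.normal⟫ = H.offset :=
  iff_of_eq (congrArg (y ∈ ·) H.exists_eq.choose_spec.choose_spec)

theorem mem_points_iff (H : Hyperplane d) (y : E d) :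
    y ∈ H.points ↔ ⟪y, H.normal⟫ = H.offset := H.mem_toAffineSubspace_iff y

theorem ext_points {H G : Hyperplane d} (h : ∀ y, y ∈ H.points ↔ y ∈ G.points) : H = G :=
  Hyperplane.ext (SetLike.ext h)

/-- The left side bounds the distance from `y` to `H`, so its sublevel sets are generators of the
sigma-field. -/
theorem abs_inner_sub_offset_le_iff (H : Hyperplane d) (y : E d) (r : ℝ) :
    |⟪y, H.normal⟫ - H.offset| ≤ r ↔ H ∈ hitting (Metric.closedBall y r) := by
  have hn : ⟪H.normal, H.normal⟫ = 1 := by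
    rw [real_inner_self_eq_norm_sq, H.norm_normal, one_pow]
  constructor
  · intro h
    -- The foot of the perpendicular from `y`.
    refine ⟨y - (⟪y, H.normal⟫ - H.offset) • H.normal, ?_, ?_⟩
    · rw [mem_points_iff, inner_sub_left, real_inner_smul_left, hn]
      ring
    · simpa [dist_eq_norm, norm_smul, H.norm_normal] using h
  · rintro ⟨z, hz, hzy⟩
    rw [mem_points_iff] at hz
    rw [← hz, ← inner_sub_left]
    refine (abs_real_inner_le_norm _ _).trans ?_
    rw [H.norm_normal, mul_one, ← dist_eq_norm, dist_comm]
    exact hzy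

/-- The normal is chosen only up to sign, so just the even expressions in normal and offset are
accessible. Polarizing this quadratic one in `y` yields the products below. -/
theorem measurable_sq_inner_sub_offset (y : E d) :
    Measurable fun H : Hyperplane d => (⟪y, H.normal⟫ - H.offset) ^ 2 := by
  have h : Measurable fun H : Hyperplane d => |⟪y, H.normal⟫ - H.offset| := by
    refine measurable_of_Iic fun r => ?_
    refine MeasurableSpace.measurableSet_generateFrom
      ⟨Metric.closedBall y r, isCompact_closedBall y r, ?_⟩
    ext H
    exact H.abs_inner_sub_offset_le_iff y r
  convert h.pow_const 2 using 2
  exact (sq_abs _).symm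

theorem measurable_offset_mul_normal (a : Fin d) :
    Measurable fun H : Hyperplane d => H.offset * H.normal a := by
  have h1 := measurable_sq_inner_sub_offset (EuclideanSpace.single a (1 : ℝ))
  have h2 := measurable_sq_inner_sub_offset (-EuclideanSpace.single a (1 : ℝ))
  have h := (h2.sub h1).div_const 4
  convert h using 2 with H
  simp only [Pi.sub_apply, inner_neg_left, EuclideanSpace.inner_single_left, map_one, one_mul]
  ring

theorem measurable_normal_mul_normal (a b : Fin d) :
    Measurable fun H : Hyperplane d => H.normal a * H.normal b := by
  have h0 := measurable_sq_inner_sub_offset (0 : E d)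
  have ha := measurable_sq_inner_sub_offset (EuclideanSpace.single a (1 : ℝ))
  have ha' := measurable_sq_inner_sub_offset (-EuclideanSpace.single a (1 : ℝ))
  have hb := measurable_sq_inner_sub_offset (EuclideanSpace.single b (1 : ℝ))
  have hb' := measurable_sq_inner_sub_offset (-EuclideanSpace.single b (1 : ℝ))
  have hs := measurable_sq_inner_sub_offset
    (EuclideanSpace.single a (1 : ℝ) + EuclideanSpace.single b (1 : ℝ))
  have hs' := measurable_sq_inner_sub_offset
    (-(EuclideanSpace.single a (1 : ℝ) + EuclideanSpace.single b (1 : ℝ)))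
  -- The values at `z` and `-z` add up to `2⟪z, n⟫² + 2 offset²`; twice the value at `0` cancels the
  -- surplus `-2 offset²`.
  have h := ((((hs.add hs').sub (ha.add ha')).sub (hb.add hb')).add (h0.const_mul 2)).div_const 4
  convert h using 2 with H
  simp only [Pi.sub_apply, Pi.add_apply, inner_neg_left, inner_add_left, inner_zero_left,
    EuclideanSpace.inner_single_left, map_one, one_mul]
  ring

theorem sum_normal_mul (H : Hyperplane d) (y : E d) (a : Fin d) :
    ∑ b, H.normal a * H.normal b * y b = ⟪y, H.normal⟫ * H.normal a := by
  rw [PiLp.inner_apply, Finset.sum_mul]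
  refine Finset.sum_congr rfl fun b _ => ?_
  simp only [RCLike.inner_apply, conj_trivial]
  ring

theorem eq_of_forall_mul_normal_eq (H : Hyperplane d) {r s : ℝ}
    (h : ∀ a, r * H.normal a = s * H.normal a) : r = s := by
  by_contra hne
  have h0 : H.normal = 0 := by
    ext a
    by_contra ha
    exact hne (mul_right_cancel₀ ha (h a))
  simpa [h0] using H.norm_normal

/-- Multiplying the equation of `H` by the coordinates of its normal makes the coefficients
independent of the sign choice, and loses nothing because the normal is nonzero. -/
theorem mem_points_iff_forall (H : Hyperplane d) (y : E d) :
    y ∈ H.points ↔ ∀ a, ∑ b, H.normal a * H.normal b * y b = H.offset * H.normal a := by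
  simp only [sum_normal_mul, mem_points_iff]
  exact ⟨fun h a => by rw [h], H.eq_of_forall_mul_normal_eq⟩

/-- Measurable coordinates that determine a hyperplane. -/
def coordinates (H : Hyperplane d) : (Fin d → Fin d → ℝ) × (Fin d → ℝ) :=
  (fun a b => H.normal a * H.normal b, fun a => H.offset * H.normal a)

theorem measurable_coordinates : Measurable (coordinates (d := d)) :=
  (measurable_pi_lambda _ fun a => measurable_pi_lambda _ fun b =>
    measurable_normal_mul_normal a b).prodMk
    (measurable_pi_lambda _ fun a => measurable_offset_mul_normal a)

theorem coordinates_injective : Function.Injective (coordinates (d := d)) := by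
  intro H G h
  refine ext_points fun y => ?_
  have h1 : ∀ a b, H.normal a * H.normal b = G.normal a * G.normal b := fun a b =>
    congrFun (congrFun (congrArg Prod.fst h) a) b
  have h2 : ∀ a, H.offset * H.normal a = G.offset * G.normal a := fun a =>
    congrFun (congrArg Prod.snd h) a
  simp only [mem_points_iff_forall, h1, h2]

theorem measurableSet_mem_points :
    MeasurableSet {p : Hyperplane d × E d | p.2 ∈ p.1.points} := by
  simp only [mem_points_iff_forall, Set.ofPred_forall]
  refine MeasurableSet.iInter fun a => measurableSet_eq_fun ?_ ?_
  · refine Finset.measurable_sum _ fun b _ => ?_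
    exact ((measurable_normal_mul_normal a b).comp measurable_fst).mul (by fun_prop)
  · exact (measurable_offset_mul_normal a).comp measurable_fst

end Hyperplane

theorem measurableSet_hitting {d : ℕ} {K : Set (E d)} (hK : IsCompact K) :
    MeasurableSet (hitting K) :=
  MeasurableSpace.measurableSet_generateFrom ⟨K, hK, rfl⟩

/-! ### Poisson processes do not charge null sets of tuples -/

/-- For finite `r` this is `1 - exp (-r) ≤ r`. -/
theorem poissonLaw_compl_zero_le (r : ℝ≥0∞) : poissonLaw r {0}ᶜ ≤ r := by
  rcases eq_or_ne r ⊤ with rfl | hr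
  · exact le_top
  have h0 : (fun n : ℕ => (n : ℕ∞)) ⁻¹' {0}ᶜ = {0}ᶜ := by
    ext n
    simp
  rw [poissonLaw, if_neg hr, Measure.map_apply .of_discrete .of_discrete, h0,
    prob_compl_eq_one_sub (measurableSet_singleton 0), poissonMeasure_singleton]
  simp only [pow_zero, mul_one, Nat.factorial_zero, Nat.cast_one, div_one]
  rw [← ENNReal.ofReal_one, ← ENNReal.ofReal_sub _ (Real.exp_nonneg _)]
  refine ENNReal.ofReal_le_of_le_toReal ?_
  have h := Real.add_one_le_exp (-r.toReal)
  change 1 - Real.exp (-r.toReal) ≤ r.toReal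
  linarith

section PoissonProcess

variable {Ω : Type*} [MeasurableSpace Ω] {P : Measure Ω} {d : ℕ} {η : Ω → Set (Hyperplane d)}
  {Λ : Measure (Hyperplane d)}

theorem IsPoissonProcess.measure_forall_nonempty_le (hη : IsPoissonProcess P η Λ) {n : ℕ}
    {C : Fin n → Set (Hyperplane d)} (hC : ∀ i, MeasurableSet (C i))
    (hdisj : Pairwise fun i j => Disjoint (C i) (C j)) :
    P {ω | ∀ i, (η ω ∩ C i).Nonempty} ≤ ∏ i, Λ (C i) := by
  have hset : {ω | ∀ i, (η ω ∩ C i).Nonempty} =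
      ⋂ i ∈ Finset.univ, (fun ω => (η ω ∩ C i).encard) ⁻¹' {0}ᶜ := by
    ext ω
    simp [Set.nonempty_iff_ne_empty]
  rw [hset, (hη.indep_count n C hC hdisj).measure_inter_preimage_eq_mul Finset.univ
    fun i _ => (measurableSet_singleton (0 : ℕ∞)).compl]
  refine Finset.prod_le_prod' fun i _ => ?_
  rw [← Measure.map_apply (hη.measurable_count _ (hC i)) (measurableSet_singleton _).compl,
    hη.law_count _ (hC i)]
  exact poissonLaw_compl_zero_le _

/-- The product outer measure is an infimum over countable covers of sums of products of the
measures of coordinate projections. If a tuple from `η` lies in a cover set, `η` hits all its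
projections, which by independence has probability at most that product. -/
theorem IsPoissonProcess.ae_forall_notMem_of_pi_null (hη : IsPoissonProcess P η Λ) {n : ℕ}
    {A : Fin n → Set (Hyperplane d)} (hA : ∀ i, MeasurableSet (A i))
    (hdisj : Pairwise fun i j => Disjoint (A i) (A j))
    {B : Set (Fin n → Hyperplane d)} (hB : MeasurableSet B)
    (hnull : Measure.pi (fun i => Λ.restrict (A i)) B = 0) :
    ∀ᵐ ω ∂P, ∀ g : Fin n → Hyperplane d, (∀ i, g i ∈ η ω ∩ A i) → g ∉ B := by
  rw [Measure.pi, toMeasure_apply _ _ hB, OuterMeasure.pi, OuterMeasure.boundedBy_apply] at hnull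
  rw [ae_iff, ← nonpos_iff_eq_zero, ← hnull]
  refine le_iInf₂ fun t ht => ?_
  -- Measurable hulls of the projections, cut back to `A i` so that they remain disjoint and
  -- independence applies.
  set C : ℕ → Fin n → Set (Hyperplane d) := fun k i =>
    toMeasurable (Λ.restrict (A i)) (Function.eval i '' t k) ∩ A i with hCdef
  have hC : ∀ k i, MeasurableSet (C k i) := fun k i =>
    (measurableSet_toMeasurable _ _).inter (hA i)
  have hsub : {ω | ¬∀ g : Fin n → Hyperplane d, (∀ i, g i ∈ η ω ∩ A i) → g ∉ B} ⊆
      ⋃ k, {ω | (t k).Nonempty ∧ ∀ i, (η ω ∩ C k i).Nonempty} := by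
    intro ω hω
    simp only [Set.mem_ofPred_eq, not_forall, not_not] at hω
    obtain ⟨g, hg, hgB⟩ := hω
    obtain ⟨k, hk⟩ := Set.mem_iUnion.mp (ht hgB)
    refine Set.mem_iUnion.mpr ⟨k, ⟨g, hk⟩, fun i => ⟨g i, (hg i).1, ?_, (hg i).2⟩⟩
    exact subset_toMeasurable _ _ ⟨g, hk, rfl⟩
  refine (measure_mono hsub).trans ((measure_iUnion_le _).trans (ENNReal.tsum_le_tsum fun k => ?_))
  by_cases hne : (t k).Nonempty
  · simp only [hne, true_and, iSup_pos]
    refine (hη.measure_forall_nonempty_le (hC k) fun i j hij =>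
      (hdisj hij).mono Set.inter_subset_right Set.inter_subset_right).trans ?_
    refine Finset.prod_le_prod' fun i _ => ?_
    rw [hCdef, ← Measure.restrict_apply (measurableSet_toMeasurable _ _), measure_toMeasurable]
    rfl
  · simp [hne]

theorem exists_disjoint_basis {T : Type*} [TopologicalSpace T] [T2Space T]
    [SecondCountableTopology T] {n : ℕ} {x : Fin n → T} (hx : Function.Injective x) :
    ∃ U : Fin n → TopologicalSpace.countableBasis T,
      (∀ i, x i ∈ (U i : Set T)) ∧ Pairwise fun i j => Disjoint (U i : Set T) (U j) := by
  obtain ⟨V, hV, hdisj⟩ := (Set.finite_range x).t2_separation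
  have h : ∀ i, ∃ U : TopologicalSpace.countableBasis T, x i ∈ (U : Set T) ∧ (U : Set T) ⊆ V (x i) :=
    fun i => by
      obtain ⟨u, hu, hxu, huV⟩ := (TopologicalSpace.isBasis_countableBasis T).exists_subset_of_mem_open
        (hV (x i)).1 (hV (x i)).2
      exact ⟨⟨u, hu⟩, hxu, huV⟩
  choose U hU hUV using h
  refine ⟨U, hU, fun i j hij => ?_⟩
  exact (hdisj (Set.mem_range_self i) (Set.mem_range_self j) (hx.ne hij)).mono (hUV i) (hUV j)

/-- Fubini: once the other hyperplanes are fixed, the zeroth one must pass through a fixed point. -/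
theorem pi_incidence_null {m : ℕ} (μ : Fin (m + 1) → Measure (Hyperplane d))
    [∀ i, SigmaFinite (μ i)] (hpt : ∀ y : E d, μ 0 (hitting {y}) = 0)
    {F : (Fin m → Hyperplane d) → E d} (hF : Measurable F) :
    MeasurableSet {g : Fin (m + 1) → Hyperplane d | F (fun i => g i.succ) ∈ (g 0).points} ∧
      Measure.pi μ {g : Fin (m + 1) → Hyperplane d | F (fun i => g i.succ) ∈ (g 0).points} = 0 := by
  have hB : MeasurableSet {p : Hyperplane d × (Fin m → Hyperplane d) | F p.2 ∈ p.1.points} :=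
    Hyperplane.measurableSet_mem_points.preimage
      (measurable_fst.prodMk (hF.comp measurable_snd))
  have he := measurePreserving_piFinSuccAbove μ 0
  have hpre : {g : Fin (m + 1) → Hyperplane d | F (fun i => g i.succ) ∈ (g 0).points} =
      MeasurableEquiv.piFinSuccAbove (fun _ => Hyperplane d) 0 ⁻¹'
        {p : Hyperplane d × (Fin m → Hyperplane d) | F p.2 ∈ p.1.points} := rfl
  rw [hpre]
  refine ⟨hB.preimage he.measurable, ?_⟩
  rw [he.measure_preimage hB.nullMeasurableSet, Measure.prod_apply_symm hB]
  refine (lintegral_congr fun g => ?_).trans lintegral_zero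
  convert hpt (F g) using 2
  ext G
  simp [hitting]

/-- Countably many products of disjoint sets, basic open in `coordinates` and bounded by a ball,
cover all injective tuples; the balls make the restricted intensities finite. -/
theorem IsPoissonProcess.ae_forall_notMem_points_fin (hη : IsPoissonProcess P η Λ)
    (hpt : ∀ y : E d, Λ (hitting {y}) = 0)
    (hball : ∀ r : ℝ, Λ (hitting (Metric.closedBall 0 r)) < ⊤) {m : ℕ}
    {F : (Fin m → Hyperplane d) → E d} (hF : Measurable F) :
    ∀ᵐ ω ∂P, ∀ g : Fin (m + 1) → Hyperplane d, Function.Injective g → (∀ i, g i ∈ η ω) →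
      F (fun i => g i.succ) ∉ (g 0).points := by
  let T := (Fin d → Fin d → ℝ) × (Fin d → ℝ)
  let A (U : Fin (m + 1) → TopologicalSpace.countableBasis T) (R : ℕ) (i : Fin (m + 1)) :
      Set (Hyperplane d) :=
    Hyperplane.coordinates ⁻¹' (U i : Set T) ∩ hitting (Metric.closedBall 0 (R : ℝ))
  have hA : ∀ U R i, MeasurableSet (A U R i) := fun U R i =>
    (Hyperplane.measurable_coordinates
      (TopologicalSpace.isOpen_of_mem_countableBasis (U i).2).measurableSet).inter
      (measurableSet_hitting (isCompact_closedBall _ _))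
  have key : ∀ (U : Fin (m + 1) → TopologicalSpace.countableBasis T) (R : ℕ),
      (Pairwise fun i j => Disjoint (U i : Set T) (U j)) →
      ∀ᵐ ω ∂P, ∀ g : Fin (m + 1) → Hyperplane d, (∀ i, g i ∈ η ω ∩ A U R i) →
        F (fun i => g i.succ) ∉ (g 0).points := by
    intro U R hU
    have hfin : ∀ i, IsFiniteMeasure (Λ.restrict (A U R i)) := fun i =>
      ⟨by simpa using (measure_mono Set.inter_subset_right).trans_lt (hball R)⟩
    obtain ⟨hm, hnull⟩ := pi_incidence_null (fun i => Λ.restrict (A U R i))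
      (fun y => Measure.restrict_le_self.absolutelyContinuous (hpt y)) hF
    exact hη.ae_forall_notMem_of_pi_null (hA U R) (fun i j hij =>
      ((hU hij).preimage _).mono Set.inter_subset_left Set.inter_subset_left) hm hnull
  have hall : ∀ᵐ ω ∂P, ∀ (U : Fin (m + 1) → TopologicalSpace.countableBasis T) (R : ℕ),
      (Pairwise fun i j => Disjoint (U i : Set T) (U j)) →
      ∀ g : Fin (m + 1) → Hyperplane d, (∀ i, g i ∈ η ω ∩ A U R i) →
        F (fun i => g i.succ) ∉ (g 0).points := by
    have : Countable (TopologicalSpace.countableBasis T) :=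
      (TopologicalSpace.countable_countableBasis T).to_subtype
    refine ae_all_iff.mpr fun U => ae_all_iff.mpr fun R => ?_
    by_cases hU : Pairwise fun i j => Disjoint (U i : Set T) (U j)
    · filter_upwards [key U R hU] with ω h _ using h
    · exact .of_forall fun ω h => absurd h hU
  filter_upwards [hall] with ω h g hg hgη
  obtain ⟨U, hgU, hU⟩ := exists_disjoint_basis (Hyperplane.coordinates_injective.comp hg)
  obtain ⟨R, hR⟩ := exists_nat_ge (∑ i, |⟪(0 : E d), (g i).normal⟫ - (g i).offset|)
  refine h U R hU g fun i => ⟨hgη i, hgU i, ?_⟩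
  rw [← Hyperplane.abs_inner_sub_offset_le_iff]
  exact (Finset.single_le_sum (f := fun i => |⟪(0 : E d), (g i).normal⟫ - (g i).offset|)
    (fun _ _ => abs_nonneg _) (Finset.mem_univ i)).trans hR

/-- Here `g` may repeat values. It factors through an enumeration of its finite range, and putting
`G` in front gives an injective tuple; there are only countably many patterns `σ` of repetition. -/
theorem IsPoissonProcess.ae_forall_notMem_points (hη : IsPoissonProcess P η Λ)
    (hpt : ∀ y : E d, Λ (hitting {y}) = 0)
    (hball : ∀ r : ℝ, Λ (hitting (Metric.closedBall 0 r)) < ⊤) {ι : Type*} [Finite ι]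
    {F : (ι → Hyperplane d) → E d} (hF : Measurable F) :
    ∀ᵐ ω ∂P, ∀ g : ι → Hyperplane d, (∀ i, g i ∈ η ω) →
      ∀ G ∈ η ω, (∀ i, g i ≠ G) → F g ∉ G.points := by
  have hall : ∀ᵐ ω ∂P, ∀ (m : ℕ) (σ : ι → Fin m) (h : Fin (m + 1) → Hyperplane d),
      Function.Injective h → (∀ i, h i ∈ η ω) → F (fun i => h (σ i).succ) ∉ (h 0).points := by
    refine ae_all_iff.mpr fun m => ae_all_iff.mpr fun σ => ?_
    exact hη.ae_forall_notMem_points_fin hpt hball (F := fun h => F fun i => h (σ i))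
      (hF.comp (measurable_pi_lambda _ fun i => measurable_pi_apply _))
  filter_upwards [hall] with ω h g hg G hG hne
  obtain ⟨m, ⟨e⟩⟩ := Finite.exists_equiv_fin (Set.range g)
  have hinj : Function.Injective
      (Fin.cons G (fun k => (e.symm k : Hyperplane d)) : Fin (m + 1) → Hyperplane d) := by
    rw [Fin.cons_injective_iff]
    refine ⟨?_, Subtype.val_injective.comp e.symm.injective⟩
    rintro ⟨k, hk⟩
    obtain ⟨i, hi⟩ := (e.symm k).2
    exact hne i (hi.trans hk)
  have := h m (fun i => e ⟨g i, i, rfl⟩) _ hinj (by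
    refine Fin.cases hG fun k => ?_
    obtain ⟨i, hi⟩ := (e.symm k).2
    rw [Fin.cons_succ, ← hi]
    exact hg i)
  simpa using this

end PoissonProcess

/-! ### Null sets and local finiteness of the intensity measure -/

theorem intensityMeasure_hitting_singleton {d : ℕ} (γ : ℝ) (Q : Measure (UnitSphere d))
    [SFinite Q] (y : E d) : intensityMeasure γ Q (hitting {y}) = 0 := by
  have hm := measurableSet_hitting (isCompact_singleton (x := y))
  rw [intensityMeasure, Measure.smul_apply, Measure.map_apply (measurable_ofNormal d) hm,
    Measure.measure_prod_null (measurable_ofNormal d hm) |>.mpr, smul_zero]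
  refine .of_forall fun u => ?_
  refine measure_mono_null (t := {⟪y, (u : E d)⟫}) ?_ Real.volume_singleton
  rintro s ⟨z, hz, rfl⟩
  exact hz.symm

theorem intensityMeasure_hitting_closedBall_lt_top {d : ℕ} (γ : ℝ) (Q : Measure (UnitSphere d))
    [IsFiniteMeasure Q] (r : ℝ) :
    intensityMeasure γ Q (hitting (Metric.closedBall 0 r)) < ⊤ := by
  have hm := measurableSet_hitting (isCompact_closedBall (0 : E d) r)
  rw [intensityMeasure, Measure.smul_apply, Measure.map_apply (measurable_ofNormal d) hm]
  refine ENNReal.mul_lt_top ENNReal.ofReal_lt_top ?_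
  refine (measure_mono (t := Set.univ ×ˢ Set.Icc (-r) r) ?_).trans_lt ?_
  · rintro ⟨u, s⟩ ⟨z, hz, hzr⟩
    have hz' : ⟪z, (u : E d)⟫ = s := hz
    refine ⟨trivial, abs_le.mp ?_⟩
    have hle := abs_real_inner_le_norm z (u : E d)
    rw [hz', norm_eq_of_mem_sphere u, mul_one] at hle
    exact hle.trans (mem_closedBall_zero_iff.mp hzr)
  · rw [Measure.prod_prod]
    exact ENNReal.mul_lt_top (measure_lt_top _ _) measure_Icc_lt_top

/-! ### Intersection points as measurable functions of the hyperplanes -/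

section Geometry

variable {d : ℕ}

/-- The common point of the hyperplanes `h k`, if there is exactly one. -/
def vertex {κ : Type*} [Fintype κ] (h : κ → Hyperplane d) : E d :=
  WithLp.toLp 2 (leastSquares
    (fun (p : κ × Fin d) b => (h p.1).normal p.2 * (h p.1).normal b)
    (fun p => (h p.1).offset * (h p.1).normal p.2))

/-- The common point of the hyperplanes `h k` and the affine span of the points `x i`, if there is
exactly one. -/
def transversal {κ ι : Type*} [Fintype κ] [Fintype ι] [DecidableEq ι] (h : κ → Hyperplane d)
    (x : ι → E d) : E d :=
  ∑ i, leastSquares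
    -- The unknowns are barycentric coordinates: row `none` says that they sum to `1`, the other
    -- rows express incidence with the `h k`.
    (fun (r : Option (κ × Fin d)) i =>
      r.elim 1 fun p => ∑ b, (h p.1).normal p.2 * (h p.1).normal b * x i b)
    (fun r => r.elim 1 fun p => (h p.1).offset * (h p.1).normal p.2) i • x i

theorem measurable_vertex {κ α : Type*} [Fintype κ] [MeasurableSpace α]
    {h : α → κ → Hyperplane d} (hh : ∀ k, Measurable fun z => h z k) :
    Measurable fun z => vertex (h z) := by
  refine (WithLp.measurable_toLp 2 _).comp (measurable_leastSquares ?_ ?_)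
  · exact fun p b => (Hyperplane.measurable_normal_mul_normal p.2 b).comp (hh p.1)
  · exact fun p => (Hyperplane.measurable_offset_mul_normal p.2).comp (hh p.1)

theorem measurable_transversal {κ ι α : Type*} [Fintype κ] [Fintype ι] [DecidableEq ι]
    [MeasurableSpace α] {h : α → κ → Hyperplane d} {x : α → ι → E d}
    (hh : ∀ k, Measurable fun z => h z k) (hx : ∀ i, Measurable fun z => x z i) :
    Measurable fun z => transversal (h z) (x z) := by
  refine Finset.measurable_sum _ fun i _ => Measurable.fun_smul ?_ (hx i)
  refine (measurable_pi_apply i).comp (measurable_leastSquares ?_ ?_)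
  · rintro (_ | p) i
    · exact measurable_const
    · refine Finset.measurable_sum _ fun b _ => Measurable.mul ?_ ?_
      · exact (Hyperplane.measurable_normal_mul_normal p.2 b).comp (hh p.1)
      · have := hx i
        fun_prop
  · rintro (_ | p)
    · exact measurable_const
    · exact (Hyperplane.measurable_offset_mul_normal p.2).comp (hh p.1)

theorem eq_zero_of_iInter_points_eq_singleton {κ : Type*} {h : κ → Hyperplane d} {x : E d}
    (hx : ⋂ k, (h k).points = {x}) {w : E d} (hw : ∀ k, ⟪w, (h k).normal⟫ = 0) : w = 0 := by
  have hxk : ∀ k, x ∈ (h k).points := Set.mem_iInter.mp (hx ▸ Set.mem_singleton x)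
  have hxw : x + w ∈ ⋂ k, (h k).points := Set.mem_iInter.mpr fun k => by
    rw [Hyperplane.mem_points_iff, inner_add_left, hw k, add_zero]
    exact ((h k).mem_points_iff x).mp (hxk k)
  rw [hx] at hxw
  simpa using hxw

theorem vertex_eq {κ : Type*} [Fintype κ] {h : κ → Hyperplane d} {x : E d}
    (hx : ⋂ k, (h k).points = {x}) : vertex h = x := by
  have hxk : ∀ k, x ∈ (h k).points := Set.mem_iInter.mp (hx ▸ Set.mem_singleton x)
  have : leastSquares (fun (p : κ × Fin d) b => (h p.1).normal p.2 * (h p.1).normal b)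
      (fun p => (h p.1).offset * (h p.1).normal p.2) = x.ofLp := by
    refine leastSquares_eq (fun c hc => ?_) fun p => ((h p.1).mem_points_iff_forall x).mp (hxk p.1) p.2
    have h0 : WithLp.toLp 2 c = (0 : E d) := by
      refine eq_zero_of_iInter_points_eq_singleton hx fun k => ?_
      refine (h k).eq_of_forall_mul_normal_eq fun a => ?_
      rw [zero_mul, ← Hyperplane.sum_normal_mul]
      exact hc (k, a)
    exact congrArg WithLp.ofLp h0
  rw [vertex, this]

theorem transversal_eq {κ ι : Type*} [Fintype κ] [Fintype ι] [DecidableEq ι]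
    {h : κ → Hyperplane d} {x : ι → E d} {y : E d} (hx : AffineIndependent ℝ x)
    (hyx : y ∈ affineSpan ℝ (Set.range x)) (hyh : ∀ k, y ∈ (h k).points)
    (huniq : ∀ w ∈ vectorSpan ℝ (Set.range x), (∀ k, ⟪w, (h k).normal⟫ = 0) → w = 0) :
    transversal h x = y := by
  obtain ⟨a, ha, hya⟩ := eq_affineCombination_of_mem_affineSpan_of_fintype hyx
  rw [Finset.affineCombination_eq_linear_combination _ _ _ ha] at hya
  have hsum : ∀ (c : ι → ℝ) (k : κ) (a : Fin d),
      ∑ i, (∑ b, (h k).normal a * (h k).normal b * x i b) * c i =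
        ⟪∑ i, c i • x i, (h k).normal⟫ * (h k).normal a := by
    intro c k a
    simp only [Hyperplane.sum_normal_mul, sum_inner, real_inner_smul_left, Finset.sum_mul]
    exact Finset.sum_congr rfl fun i _ => by ring
  rw [transversal, leastSquares_eq (a := a), ← hya]
  · intro c hc
    have hc0 : ∑ i, c i = 0 := by simpa using hc none
    have hw : ∑ i, c i • x i = 0 := by
      refine huniq _ ?_ fun k => (h k).eq_of_forall_mul_normal_eq fun a => ?_
      · have := weightedVSub_mem_vectorSpan (s := Finset.univ) hc0 x
        rwa [Finset.univ.weightedVSub_eq_linear_combination hc0] at this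
      · rw [zero_mul, ← hsum]
        exact hc (some (k, a))
    funext i
    exact affineIndependent_iff.mp hx Finset.univ c hc0 hw i (Finset.mem_univ i)
  · rintro (_ | ⟨k, b⟩)
    · simpa using ha
    · refine (hsum a k b).trans ?_
      rw [← hya, ((h k).mem_points_iff y).mp (hyh k)]
      rfl

/-! ### Points in general hyperplane position -/

theorem Hyperplane.eq_of_le {H G : Hyperplane d} (h : H.toAffineSubspace ≤ G.toAffineSubspace) :
    H = G := by
  have hle : ∀ y, ⟪y, H.normal⟫ = H.offset → ⟪y, G.normal⟫ = G.offset := fun y hy =>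
    (G.mem_toAffineSubspace_iff y).mp (h ((H.mem_toAffineSubspace_iff y).mpr hy))
  have hn : ⟪H.normal, H.normal⟫ = 1 := by
    rw [real_inner_self_eq_norm_sq, H.norm_normal, one_pow]
  have hp : ⟪H.offset • H.normal, H.normal⟫ = H.offset := by
    rw [real_inner_smul_left, hn, mul_one]
  have hperp : ∀ w, ⟪w, H.normal⟫ = 0 → ⟪w, G.normal⟫ = 0 := fun w hw => by
    have h1 := hle (H.offset • H.normal + w) (by rw [inner_add_left, hp, hw, add_zero])
    rw [inner_add_left, hle _ hp] at h1
    linarith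
  set c := ⟪G.normal, H.normal⟫ with hc
  have hw : ⟪G.normal - c • H.normal, H.normal⟫ = 0 := by
    rw [inner_sub_left, real_inner_smul_left, hn, mul_one, ← hc, sub_self]
  have hG : G.normal = c • H.normal := by
    rw [← sub_eq_zero, ← inner_self_eq_zero (𝕜 := ℝ), inner_sub_right, hperp _ hw,
      real_inner_smul_right, hw, mul_zero, sub_zero]
  have hc0 : c ≠ 0 := by
    intro h0
    have := G.norm_normal
    rw [hG, h0] at this
    simp at this
  have hoff : c * H.offset = G.offset := by
    have h1 := hle _ hp
    rwa [hG, real_inner_smul_right, hp] at h1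
  refine Hyperplane.ext_points fun y => ?_
  rw [Hyperplane.mem_points_iff, Hyperplane.mem_points_iff, hG, real_inner_smul_right, ← hoff]
  exact (mul_right_inj' hc0).symm

/-- The `d` normals have trivial orthogonal complement, so they span and form a basis. -/
theorem injective_of_iInter_points_eq_singleton {h : Fin d → Hyperplane d} {x : E d}
    (hx : ⋂ k, (h k).points = {x}) : Function.Injective h := by
  have hli : LinearIndependent ℝ fun k => (h k).normal := by
    refine linearIndependent_of_top_le_span_of_card_eq_finrank ?_ (by simp)
    rw [top_le_iff, ← Submodule.orthogonal_eq_bot_iff, Submodule.eq_bot_iff]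
    intro w hw
    refine eq_zero_of_iInter_points_eq_singleton hx fun k => ?_
    rw [real_inner_comm]
    exact hw _ (Submodule.subset_span ⟨k, rfl⟩)
  exact hli.injective.of_comp (f := Hyperplane.normal)

/-- A linear hyperplane is transversal to one of the lines that are spanned by the edges at a
vertex. -/
theorem exists_transversal_edge {h : Fin d → Hyperplane d} {x : E d}
    (hx : ⋂ k, (h k).points = {x}) {v : E d} (hv : v ≠ 0) :
    ∃ j, ∀ w, ⟪w, v⟫ = 0 → (∀ k, k ≠ j → ⟪w, (h k).normal⟫ = 0) → w = 0 := by
  -- Otherwise every edge line contains a nonzero `w j` orthogonal to `v`. The `w j` are dual to the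
  -- normals up to nonzero factors, hence a basis, which forces `v = 0`.
  by_contra! hcon
  choose w hwv hwk hw0 using hcon
  have hdiag : ∀ j, ⟪w j, (h j).normal⟫ ≠ 0 := fun j hj =>
    hw0 j (eq_zero_of_iInter_points_eq_singleton hx fun k => by
      rcases eq_or_ne k j with rfl | hk
      · exact hj
      · exact hwk j k hk)
  have hli : LinearIndependent ℝ w := by
    rw [Fintype.linearIndependent_iff]
    intro c hc k
    have h1 : ⟪∑ j, c j • w j, (h k).normal⟫ = c k * ⟪w k, (h k).normal⟫ := by
      rw [sum_inner, Finset.sum_eq_single k]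
      · rw [real_inner_smul_left]
      · intro j _ hj
        rw [real_inner_smul_left, hwk j k hj.symm, mul_zero]
      · simp
    rw [hc, inner_zero_left] at h1
    exact (mul_eq_zero.mp h1.symm).resolve_right (hdiag k)
  have hspan := hli.span_eq_top_of_card_eq_finrank' (by simp)
  have hvmem : v ∈ (Submodule.span ℝ (Set.range w))ᗮ := by
    rw [Submodule.mem_orthogonal]
    intro y hy
    induction hy using Submodule.span_induction with
    | mem y hy => obtain ⟨j, rfl⟩ := hy; exact hwv j
    | zero => exact inner_zero_left v
    | add y z _ _ hy hz => rw [inner_add_left, hy, hz, add_zero]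
    | smul c y _ hy => rw [real_inner_smul_left, hy, mul_zero]
  rw [hspan, Submodule.top_orthogonal_eq_bot] at hvmem
  exact hv hvmem

/-- If `d` of the points were on `G`, their span `H` would be `G`. So at most `d - 1` are, and `(2d
- 1) - (d - 1) = d` remain; this is where the number `2d - 1` enters. -/
theorem exists_card_eq_forall_notMem_points {x : Fin (2 * d - 1) → E d} {H G : Hyperplane d}
    (hspan : ∀ t : Finset (Fin (2 * d - 1)), t.card = d →
      affineSpan ℝ (x '' (t : Set (Fin (2 * d - 1)))) = H.toAffineSubspace) (hHG : H ≠ G) :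
    ∃ t : Finset (Fin (2 * d - 1)), t.card = d ∧ ∀ i ∈ t, x i ∉ G.points := by
  classical
  have hlt : (Finset.univ.filter fun i => x i ∈ G.points).card < d := by
    by_contra! hle
    obtain ⟨t, ht, htd⟩ := Finset.exists_subset_card_eq hle
    refine hHG (Hyperplane.eq_of_le ?_)
    rw [← hspan t htd, affineSpan_le]
    rintro _ ⟨i, hi, rfl⟩
    exact (Finset.mem_filter.mp (ht hi)).2
  have hcard := Finset.card_filter_add_card_filter_not (s := (Finset.univ : Finset (Fin (2 * d - 1))))
    fun i => x i ∈ G.points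
  rw [Finset.card_univ, Fintype.card_fin] at hcard
  obtain ⟨t, ht, htd⟩ := Finset.exists_subset_card_eq
    (show d ≤ (Finset.univ.filter fun i => x i ∉ G.points).card by omega)
  exact ⟨t, htd, fun i hi => (Finset.mem_filter.mp (ht hi)).2⟩

/-- The intersection point of an edge line and the hyperplane through `d` vertices, as a function
of the hyperplanes that determine the line and the vertices. -/
def edgePoint (j : Fin d) (g : {k : Fin d // k ≠ j} ⊕ Fin d × Fin d → Hyperplane d) : E d :=
  transversal (fun k => g (.inl k)) fun i : Fin d => vertex fun k => g (.inr (i, k))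

theorem measurable_edgePoint (j : Fin d) : Measurable (edgePoint j) :=
  measurable_transversal (fun _ => measurable_pi_apply _) fun _ =>
    measurable_vertex fun _ => measurable_pi_apply _

theorem exists_edgePoint_mem_points (hd : 1 ≤ d) {S : Set (Hyperplane d)}
    {x : Fin (2 * d - 1) → E d} (hx : ∀ i, x i ∈ intersectionPoints S) {H : Hyperplane d}
    (hgen : ∀ t : Finset (Fin (2 * d - 1)), t.card = d →
      AffineIndependent ℝ (fun i : t => x i) ∧
        affineSpan ℝ (x '' (t : Set (Fin (2 * d - 1)))) = H.toAffineSubspace)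
    (hxH : ∀ i, x i ∈ H.toAffineSubspace) (hHS : H ∉ S) :
    ∃ (j : Fin d) (g : {k : Fin d // k ≠ j} ⊕ Fin d × Fin d → Hyperplane d),
      (∀ i, g i ∈ S) ∧ ∃ G ∈ S, (∀ i, g i ≠ G) ∧ edgePoint j g ∈ G.points := by
  choose h hS hh using hx
  have hmem : ∀ i k, x i ∈ (h i k).points := fun i =>
    Set.mem_iInter.mp (hh i ▸ Set.mem_singleton (x i))
  let o : Fin (2 * d - 1) := ⟨0, by omega⟩
  have hv : H.normal ≠ 0 := fun h0 => by simpa [h0] using H.norm_normal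
  obtain ⟨j, hj⟩ := exists_transversal_edge (hh o) hv
  have hHG : H ≠ h o j := fun h0 => hHS (h0 ▸ hS o j)
  obtain ⟨t, htd, ht⟩ := exists_card_eq_forall_notMem_points (fun t ht => (hgen t ht).2) hHG
  let e : Fin d ≃ t := (t.equivFinOfCardEq htd).symm
  have hrange : Set.range (fun i => x (e i)) = x '' (t : Set (Fin (2 * d - 1))) := by
    ext y
    constructor
    · rintro ⟨i, rfl⟩
      exact ⟨e i, (e i).2, rfl⟩
    · rintro ⟨i, hi, rfl⟩
      exact ⟨e.symm ⟨i, hi⟩, by simp⟩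
  have hspan : affineSpan ℝ (Set.range fun i => x (e i)) = H.toAffineSubspace := by
    rw [hrange, (hgen t htd).2]
  refine ⟨j, Sum.elim (fun k => h o k) (fun p => h (e p.1) p.2), ?_, h o j, hS o j, ?_, ?_⟩
  · rintro (k | p)
    exacts [hS o k, hS _ _]
  -- No determining hyperplane is `G`: those of the edge differ from it as the hyperplanes at a
  -- vertex are distinct, the others contain a vertex that avoids `G`.
  · rintro (k | ⟨i, k⟩) heq
    · exact k.2 (injective_of_iInter_points_eq_singleton (hh o) heq)
    · exact ht (e i) (e i).2 (heq ▸ hmem (e i) k)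
  · have hpt : edgePoint j (Sum.elim (fun k => h o k) (fun p => h (e p.1) p.2)) = x o := by
      simp only [edgePoint, Sum.elim_inl, Sum.elim_inr, vertex_eq (hh _)]
      refine transversal_eq ((hgen t htd).1.comp_embedding e.toEmbedding) ?_
        (fun k => hmem o k) fun w hw hwk => hj w ?_ fun k hk => hwk ⟨k, hk⟩
      · exact hspan ▸ hxH o
      · have hw' : w ∈ H.toAffineSubspace.direction := by
          rwa [← hspan, direction_affineSpan]
        have := (H.mem_toAffineSubspace_iff _).mp
          (AffineSubspace.vadd_mem_of_mem_direction hw' (hxH o))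
        rw [vadd_eq_add, inner_add_left, (H.mem_toAffineSubspace_iff _).mp (hxH o)] at this
        linarith
    rw [hpt]
    exact hmem o j

theorem affineSpan_range_eq_of_generalPosition {n : ℕ} (hd : 1 ≤ d) (hdn : d ≤ n)
    {x : Fin n → E d} {H : Hyperplane d}
    (hspan : ∀ t : Finset (Fin n), t.card = d →
      affineSpan ℝ (x '' (t : Set (Fin n))) = H.toAffineSubspace) :
    affineSpan ℝ (Set.range x) = H.toAffineSubspace := by
  refine le_antisymm (affineSpan_le.mpr ?_) ?_
  · rintro _ ⟨i, rfl⟩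
    obtain ⟨t, hit, -, ht⟩ := Finset.exists_subsuperset_card_eq (Finset.subset_univ {i})
      (by simpa using hd) (by simpa using hdn)
    rw [← hspan t ht]
    exact subset_affineSpan ℝ _ ⟨i, by simpa using hit, rfl⟩
  · obtain ⟨t, -, ht⟩ := Finset.exists_subset_card_eq (s := (Finset.univ : Finset (Fin n)))
      (by simpa using hdn)
    rw [← hspan t ht]
    exact affineSpan_mono ℝ (Set.image_subset_range _ _)

end Geometry

end PoissonHyperplane

end

open PoissonHyperplane in
theorem proposition3p1 {Ω : Type*} [MeasurableSpace Ω] (P : Measure Ω) [IsProbabilityMeasure P]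
    (d : ℕ) (hd : 1 ≤ d)
    (γ : ℝ) (hγ : 0 < γ)
    (Q : Measure (UnitSphere d)) [IsProbabilityMeasure Q]
    (hQ_even : Q.map (fun u => -u) = Q)
    (hQ_subsphere : ∀ v : UnitSphere d, Q {u | ⟪(u : E d), (v : E d)⟫ = 0} ≠ 1)
    (η : Ω → Set (Hyperplane d))
    (hη : IsPoissonProcess P η (intensityMeasure γ Q)) :
    ∀ᵐ ω ∂P, ∀ x : Fin (2 * d - 1) → E d,
      (∀ i, x i ∈ intersectionPoints (η ω)) → Function.Injective x →
      GeneralHyperplanePosition x →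
      ∃ H ∈ η ω, affineSpan ℝ (Set.range x) = H.toAffineSubspace := by
  have hae := ae_all_iff.mpr fun j : Fin d =>
    hη.ae_forall_notMem_points (intensityMeasure_hitting_singleton γ Q)
      (intensityMeasure_hitting_closedBall_lt_top γ Q) (measurable_edgePoint j)
  filter_upwards [hae] with ω h x hx _ hgen
  obtain ⟨hdn, H, hH⟩ := hgen
  have hspan := affineSpan_range_eq_of_generalPosition hd hdn fun t ht => (hH t ht).2
  refine ⟨H, ?_, hspan⟩
  by_contra hHη
  obtain ⟨j, g, hg, G, hG, hgG, hmem⟩ := exists_edgePoint_mem_points hd hx hH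
    (fun i => hspan ▸ subset_affineSpan ℝ _ ⟨i, rfl⟩) hHη
  exact h j g hg G hG hgG hmem
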